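/- A map on a closed connected oriented surface is understood combinatorially, as a gluing of finitely many oriented polygons along their sides: a finite set of polygon sides with a permutation sending each side to the next (counterclockwise) side of its polygon and a fixed-point-free involution sending each side to the side to which it is glued. A football pattern is such a map in which at least three edges meet at every vertex, all polygons are pentagons and hexagons, the edges of each pentagon meet only edges of hexagons, and the edges of each hexagon alternately meet edges of pentagons and of hexagons. The number of pentagons is then $6d$ and the number of hexagons $10d$ for some integer $d\ge 1$. A football pattern $Q$ is a branched cover of degree $D$ of a football pattern $P$ if there is a map from the sides of $Q$ to the sides of $P$ that is compatible with the cyclic order of the sides of each polygon and with the gluing, preserves the number of sides of polygons, and under which every side of $P$ has exactly $D$ preimages; this is an orientation-preserving branched covering of surfaces of degree $D$, branched at most in the vertices, such that $Q$ is the lift of $P$. The standard football $F_0$ is the truncated icosahedron, with $12$ pentagons and $20$ hexagons. **Theorem (Footballs of positive genera).** The standard football $F_0$ is a football pattern on the sphere with exactly three edges meeting at every vertex, and: 1. Every football pattern $P$ on a closed connected oriented surface has, for some $D\le 60$, a branched cover of degree $D$ by a football pattern $Q$ that is also a branched cover, of some degree, of $F_0$. 2. The bound $60$ is sharp. Let $F$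 be obtained from $F_0$ by keeping the gluing of the sides and reordering the sides $e_1,\dots,e_6$ of every hexagon (in cyclic order, with $e_1,e_3,e_5$ glued to pentagons) cyclically as $e_1,e_4,e_3,e_6,e_5,e_2$. Then $F$ is a football pattern of genus $24$ with $d=2$ ($12$ pentagons and $20$ hexagons), it is symmetric (it admits automorphisms that rotate about any given pentagon by one side, about any given hexagon by two sides, and that interchange the two sides of any given edge between two hexagons), and the least degree $D$ of a branched cover of $F$ by a football pattern that is also a branched cover of $F_0$ is exactly $60$. -/

import Mathlib

universe u v

/-- A map on a closed oriented surface, presented as a gluing of finitely many oriented polygons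
along their sides. A *dart* is a side of a polygon, directed so that the polygon lies on its left.
`next` sends a side to the following side of the same polygon in the counterclockwise order, and
`opp` sends a side to the side (of the same or of another polygon) to which it is glued, with
reversed direction. The polygons (faces) of the map are the cycles of `next`, its edges are the
orbits of `opp`. Dually, `(next, opp)` is the ribbon graph with one vertex for each polygon, whose
half-edges are the darts, cyclically ordered at each vertex by `next`. -/
structure OrientedMap where
  /-- the sides of the polygons -/
  Dart : Type u
  finite : Finite Dart
  /-- the next side of the same polygon -/
  next : Equiv.Perm Dart
  /-- the side glued to a given side -/
  opp : Equiv.Perm Dart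
  opp_opp : ∀ d, opp (opp d) = d
  opp_ne : ∀ d, opp d ≠ d

namespace OrientedMap

/-- Counterclockwise rotation about the vertex at which a dart starts: `opp d` ends at that vertex,
and `next (opp d)` is the dart of the same polygon that starts there. The vertices of the map are
the cycles of this permutation. -/
def rot (M : OrientedMap.{u}) : Equiv.Perm M.Dart := M.next * M.opp

/-- The number of sides of the polygon on the left of a dart. -/
noncomputable def polygonSize (M : OrientedMap.{u}) (d : M.Dart) : ℕ :=
  Function.minimalPeriod M.next d

/-- The number of edges (loops counted twice) meeting at the vertex where a dart starts. -/
noncomputable def vertexDegree (M : OrientedMap.{u}) (d : M.Dart) : ℕ :=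
  Function.minimalPeriod M.rot d

/-- The set of polygons. -/
def Polygon (M : OrientedMap.{u}) : Type u := Quotient (Equiv.Perm.SameCycle.setoid M.next)

/-- The set of edges. -/
def Edge (M : OrientedMap.{u}) : Type u := Quotient (Equiv.Perm.SameCycle.setoid M.opp)

/-- The set of vertices. -/
def Vertex (M : OrientedMap.{u}) : Type u := Quotient (Equiv.Perm.SameCycle.setoid M.rot)

/-- The polygon to which a side belongs. -/
def polygonOf (M : OrientedMap.{u}) (d : M.Dart) : M.Polygon :=
  Quotient.mk (Equiv.Perm.SameCycle.setoid M.next) d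

/-- The number of polygons with exactly `k` sides. -/
noncomputable def numPolygons (M : OrientedMap.{u}) (k : ℕ) : ℕ :=
  Nat.card {F : M.Polygon // ∃ d, M.polygonOf d = F ∧ M.polygonSize d = k}

/-- The Euler characteristic of the underlying surface. -/
noncomputable def eulerChar (M : OrientedMap.{u}) : ℤ :=
  (Nat.card M.Vertex : ℤ) - (Nat.card M.Edge : ℤ) + (Nat.card M.Polygon : ℤ)

/-- The underlying surface is connected (and non-empty): one can pass from any side of a polygon to
any other one by going around polygons and crossing edges. -/
def IsConnected (M : OrientedMap.{u}) : Prop :=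
  Nonempty M.Dart ∧
    ∀ d e : M.Dart, ∃ g ∈ Subgroup.closure ({M.next, M.opp} : Set (Equiv.Perm M.Dart)), g d = e

/-- The underlying surface is connected of genus `g`. -/
def HasGenus (M : OrientedMap.{u}) (g : ℕ) : Prop :=
  M.IsConnected ∧ M.eulerChar = 2 - 2 * (g : ℤ)

/-- A football pattern on a closed connected oriented surface: at least three edges meet at every
vertex, all polygons are pentagons and hexagons, the edges of each pentagon meet only edges of
hexagons, and the edges of each hexagon alternately meet edges of pentagons and of hexagons. -/
structure IsFootballPattern (M : OrientedMap.{u}) : Prop where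
  connected : M.IsConnected
  three_le_vertexDegree : ∀ d, 3 ≤ M.vertexDegree d
  pentagon_or_hexagon : ∀ d, M.polygonSize d = 5 ∨ M.polygonSize d = 6
  pentagon_opp : ∀ d, M.polygonSize d = 5 → M.polygonSize (M.opp d) = 6
  hexagon_alternate : ∀ d, M.polygonSize d = 6 →
    (M.polygonSize (M.opp (M.next d)) = 5 ↔ M.polygonSize (M.opp d) = 6)

/-- `f` describes an orientation-preserving branched covering of degree `D` from the surface of `M`
to the surface of `N`, branched at most in the vertices, such that `M` is the lift of `N`:
it maps polygons to polygons without branching (`map_polygonSize`), compatibly with the gluing,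
and each side of a polygon of `N` has exactly `D` preimages. -/
structure IsBranchedCover (M : OrientedMap.{u}) (N : OrientedMap.{v}) (f : M.Dart → N.Dart)
    (D : ℕ) : Prop where
  map_next : ∀ d, f (M.next d) = N.next (f d)
  map_opp : ∀ d, f (M.opp d) = N.opp (f d)
  map_polygonSize : ∀ d, M.polygonSize d = N.polygonSize (f d)
  card_fiber : ∀ e, Nat.card {d // f d = e} = D

/-- `M` is a branched cover of `N` of degree `D`, branched at most in the vertices. -/
def BranchedCovers (M : OrientedMap.{u}) (N : OrientedMap.{v}) (D : ℕ) : Prop :=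
  ∃ f : M.Dart → N.Dart, IsBranchedCover M N f D

/-- An orientation-preserving automorphism of a map. -/
def IsAut (M : OrientedMap.{u}) (φ : Equiv.Perm M.Dart) : Prop :=
  (∀ d, φ (M.next d) = M.next (φ d)) ∧ ∀ d, φ (M.opp d) = M.opp (φ d)

/-- A football pattern with all possible rotations as automorphisms: the rotations of order five
about every pentagon, of order three about every hexagon, and of order two about every edge
separating two hexagons. -/
def IsSymmetricFootball (M : OrientedMap.{u}) : Prop :=
  M.IsFootballPattern ∧
    (∀ d, M.polygonSize d = 5 → ∃ φ, M.IsAut φ ∧ φ d = M.next d) ∧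
    (∀ d, M.polygonSize d = 6 → ∃ φ, M.IsAut φ ∧ φ d = M.next (M.next d)) ∧
    (∀ d, M.polygonSize d = 6 → M.polygonSize (M.opp d) = 6 → ∃ φ, M.IsAut φ ∧ φ d = M.opp d)

end OrientedMap

namespace Icosahedron

/-- The vertices of the icosahedron: two poles, five vertices `upper i` around the north pole, and
five vertices `lower i` around the south pole, indexed cyclically from west to east. The vertex
`lower i` is adjacent to `upper i` and `upper (i + 1)`. -/
inductive Vertex : Type
  | north | south
  | upper (i : Fin 5)
  | lower (i : Fin 5)
  deriving DecidableEq, Fintype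

open Vertex

/-- A directed edge of the icosahedron: the pair `(p, j)` is the edge that leads from `p` to its
`j`-th neighbour, in the counterclockwise order seen from outside. The neighbours are
* of `north`: `upper j`, for `j = 0, …, 4`,
* of `upper i`: `north`, `upper (i - 1)`, `lower (i - 1)`, `lower i`, `upper (i + 1)`,
* of `lower i`: `upper (i + 1)`, `upper i`, `lower (i - 1)`, `south`, `lower (i + 1)`,
* of `south`: `lower (-j)`, for `j = 0, …, 4`. -/
abbrev Arc : Type := Vertex × Fin 5

/-- The same edge with the opposite direction. -/
def reverse : Arc → Arc
  | (north, j) => (upper j, 0)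
  | (upper i, 0) => (north, i)
  | (upper i, 1) => (upper (i - 1), 4)
  | (upper i, 2) => (lower (i - 1), 0)
  | (upper i, 3) => (lower i, 1)
  | (upper i, 4) => (upper (i + 1), 1)
  | (lower i, 0) => (upper (i + 1), 2)
  | (lower i, 1) => (upper i, 3)
  | (lower i, 2) => (lower (i - 1), 4)
  | (lower i, 3) => (south, -i)
  | (lower i, 4) => (lower (i + 1), 2)
  | (south, j) => (lower (-j), 3)

theorem reverse_reverse : ∀ a, reverse (reverse a) = a := by decide

theorem reverse_ne : ∀ a, reverse a ≠ a := by decide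

/-- The next directed edge with the same initial vertex, counterclockwise. -/
def turn : Equiv.Perm Arc where
  toFun a := (a.1, a.2 + 1)
  invFun a := (a.1, a.2 - 1)
  left_inv a := by simp
  right_inv a := by simp

/-- The next directed edge along the triangle on the left of a directed edge. -/
def triangle : Equiv.Perm Arc where
  toFun a := turn.symm (reverse a)
  invFun a := reverse (turn a)
  left_inv a := by simp [reverse_reverse]
  right_inv a := by simp [reverse_reverse]

end Icosahedron

open Icosahedron

/-- The sides of the polygons of the truncated icosahedron. An arc `a` of the icosahedron from `p`
to `q` has a triangle on its left. Truncation cuts off from this triangle its corner at `p`;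
the cut is the side `pent a` of the pentagon that replaces `p`, and it is the side `corner a` of the
hexagon that remains of the triangle. The remaining part of `a` is the side `edge a` of this
hexagon. -/
inductive FootballSide : Type
  | pent (a : Arc)
  | corner (a : Arc)
  | edge (a : Arc)
  deriving DecidableEq, Fintype

namespace FootballSide

/-- The side of the neighbouring polygon to which a side is glued. -/
def opp : FootballSide → FootballSide
  | pent a => corner a
  | corner a => pent a
  | edge a => edge (reverse a)

theorem opp_opp (s : FootballSide) : opp (opp s) = s := by
  cases s <;> simp [opp, reverse_reverse]

theorem opp_ne (s : FootballSide) : opp s ≠ s := by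
  cases s <;> simp [opp, reverse_ne]

/-- `opp` as a permutation. -/
def oppPerm : Equiv.Perm FootballSide := ⟨opp, opp, opp_opp, opp_opp⟩

/-- The next side of the same polygon of the truncated icosahedron, counterclockwise. -/
def next : Equiv.Perm FootballSide where
  toFun
    | pent a => pent (turn a)
    | corner a => edge a
    | edge a => corner (triangle a)
  invFun
    | pent a => pent (turn.symm a)
    | corner a => edge (triangle.symm a)
    | edge a => corner a
  left_inv s := by cases s <;> simp
  right_inv s := by cases s <;> simp

/-- The cyclic order obtained from `next` by reordering the sides `e₁, …, e₆` of every hexagon as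
`e₁, e₄, e₃, e₆, e₅, e₂`, where `e₁, e₃, e₅` are glued to pentagons. -/
def twistedNext : Equiv.Perm FootballSide where
  toFun
    | pent a => pent (turn a)
    | corner a => edge (triangle a)
    | edge a => corner a
  invFun
    | pent a => pent (turn.symm a)
    | corner a => edge a
    | edge a => corner (triangle.symm a)
  left_inv s := by cases s <;> simp
  right_inv s := by cases s <;> simp

/-- `e₁ ↦ e₄`, `e₃ ↦ e₆` and `e₅ ↦ e₂`. -/
theorem twistedNext_corner (a : Arc) :
    twistedNext (corner a) = next (next (next (corner a))) := rfl

/-- `e₄ ↦ e₃`, `e₆ ↦ e₅` and `e₂ ↦ e₁`. -/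
theorem twistedNext_edge (a : Arc) : twistedNext (edge a) = next.symm (edge a) := rfl

end FootballSide

/-- The standard football: the truncated icosahedron, with 12 pentagons and 20 hexagons. -/
def standardFootball : OrientedMap.{0} where
  Dart := FootballSide
  finite := inferInstance
  next := FootballSide.next
  opp := FootballSide.oppPerm
  opp_opp := FootballSide.opp_opp
  opp_ne := FootballSide.opp_ne

/-- The football pattern obtained from the standard football by reordering the sides of every
hexagon as in `FootballSide.twistedNext`, while keeping the gluing of the sides. -/
def twistedFootball : OrientedMap.{0} where
  Dart := FootballSide
  finite := inferInstance
  next := FootballSide.twistedNext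
  opp := FootballSide.oppPerm
  opp_opp := FootballSide.opp_opp
  opp_ne := FootballSide.opp_ne

/-- The set of degrees of those football patterns that are branched covers of the football pattern
`P` and at the same time branched covers of the standard football, of any degree `E`. -/
def commonCoverDegrees (P : OrientedMap.{u}) : Set ℕ :=
  {D | ∃ Q : OrientedMap.{u}, Q.IsFootballPattern ∧ Q.BranchedCovers P D ∧
    ∃ E : ℕ, Q.BranchedCovers standardFootball E}

/-! Upper bound: in the fibre product of `P` and the standard football, take the component of a pair
of pentagonal sides. Call the size of the polygon of a side, together with the size of the polygon
across it, its type. In a football pattern the type of a side determines the types of the next and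
of the glued side, so both members of every pair in this component have the same type. Hence both
projections preserve polygon sizes and are branched covers. A fibre over a pentagonal side of `P`
injects into the 60 pentagonal sides of the standard football (`exists_common_cover`).

Sharpness: pentagonal sides of both footballs are indexed by the 60 arcs of the icosahedron. For a
common cover `Q`, the pairs of arcs lying below its pentagonal sides are closed under `turn` on both
arcs, `triangle` on both arcs, and `twistedReverse` on the first with `reverse` on the second. On
arcs, `reverse` is `turn * triangle`, and `twistedReverse` is its conjugate by `triangle`. This
gives a word that fixes every first arc and acts on the second as the commutator `shift`. Since
`shift` and its conjugate by `turn` act transitively on arcs, all pairs occur (`forall_pair`), and a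
fibre over the twisted football has at least 60 points.

The genera follow from the vertex degrees 3 and 15. The symmetry holds because the rotations of the
icosahedron commute with the twist and are transitive on arcs. -/

/-! ### Counting cycles of a permutation -/

/-- The points of period `k` of a permutation form cycles of `k` points each. -/
theorem Equiv.Perm.card_cycles_mul_period {α : Type*} [Finite α] (σ : Equiv.Perm α) (k : ℕ) :
    Nat.card {C : Quotient (Equiv.Perm.SameCycle.setoid σ) //
      ∃ d, Quotient.mk (Equiv.Perm.SameCycle.setoid σ) d = C ∧
        Function.minimalPeriod σ d = k} * k =
      Nat.card {d // Function.minimalPeriod σ d = k} := by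
  have hper : ∀ d, d ∈ Function.periodicPts σ := fun d =>
    (σ.injective.mem_periodicPts) d
  have key : ∀ (d : α) (n : ℕ), Function.minimalPeriod σ (σ^[n] d) =
      Function.minimalPeriod σ d := fun d n =>
    Function.minimalPeriod_apply_iterate (hper d) n
  have hmk : ∀ (d : α) (n : ℕ), Quotient.mk (Equiv.Perm.SameCycle.setoid σ) (σ^[n] d) =
      Quotient.mk (Equiv.Perm.SameCycle.setoid σ) d := fun d n => by
    apply Quotient.sound
    change σ.SameCycle _ _
    rw [← Equiv.Perm.coe_pow, Equiv.Perm.sameCycle_pow_left]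
  -- A cycle and a position `i < k` correspond to the `i`-th iterate of a chosen point of period
  -- `k`. For `k = 0` both sides are empty, since every point is periodic.
  let φ : {C : Quotient (Equiv.Perm.SameCycle.setoid σ) //
      ∃ d, Quotient.mk (Equiv.Perm.SameCycle.setoid σ) d = C ∧
        Function.minimalPeriod σ d = k} × Fin k → {d // Function.minimalPeriod σ d = k} :=
    fun x => ⟨σ^[x.2] x.1.2.choose, by rw [key]; exact x.1.2.choose_spec.2⟩
  have hφ : Function.Bijective φ := by
    constructor
    · rintro ⟨C, i⟩ ⟨C', j⟩ h
      have h' : σ^[i] C.2.choose = σ^[j] C'.2.choose := congrArg Subtype.val h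
      have hC : C = C' := by
        apply Subtype.ext
        rw [← C.2.choose_spec.1, ← C'.2.choose_spec.1, ← hmk _ i, h', hmk]
      subst hC
      have hp := C.2.choose_spec.2
      rw [Function.iterate_eq_iterate_iff_of_lt_minimalPeriod (by rw [hp]; exact i.2)
        (by rw [hp]; exact j.2)] at h'
      rw [Fin.ext h']
    · rintro ⟨d, hd⟩
      let C : {C : Quotient (Equiv.Perm.SameCycle.setoid σ) //
        ∃ d, Quotient.mk (Equiv.Perm.SameCycle.setoid σ) d = C ∧
          Function.minimalPeriod σ d = k} := ⟨_, d, rfl, hd⟩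
      have h1 : σ.SameCycle C.2.choose d := Quotient.exact C.2.choose_spec.1
      obtain ⟨n, hn⟩ := h1.exists_nat_pow_eq
      have hp := C.2.choose_spec.2
      have hk : 0 < k := hd ▸ Function.minimalPeriod_pos_of_mem_periodicPts (hper d)
      refine ⟨(C, ⟨n % k, Nat.mod_lt _ hk⟩), Subtype.ext ?_⟩
      change σ^[n % k] C.2.choose = d
      have hmod := Function.iterate_mod_minimalPeriod_eq (f := σ) (x := C.2.choose) (n := n)
      rw [hp] at hmod
      rw [hmod, ← Equiv.Perm.coe_pow, hn]
  rw [← Nat.card_eq_of_bijective φ hφ, Nat.card_prod, Nat.card_fin]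

/-- If all cycles of a permutation have length `k`, then their number is the number of points
divided by `k`. -/
theorem Equiv.Perm.card_quotient_sameCycle_mul {α : Type*} [Finite α] (σ : Equiv.Perm α) (k : ℕ)
    (h : ∀ d, Function.minimalPeriod σ d = k) :
    Nat.card (Quotient (Equiv.Perm.SameCycle.setoid σ)) * k = Nat.card α := by
  have := σ.card_cycles_mul_period k
  rw [Nat.card_congr (Equiv.subtypeUnivEquiv h), Nat.card_congr (Equiv.subtypeUnivEquiv _)] at this
  · exact this
  · exact fun C => C.inductionOn fun d => ⟨d, rfl, h d⟩

/-! ### Components, products and common branched covers -/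

namespace OrientedMap

variable {M : OrientedMap.{u}} {N : OrientedMap.{v}}

instance (M : OrientedMap.{u}) : Finite M.Dart := M.finite

theorem polygonSize_next (d : M.Dart) : M.polygonSize (M.next d) = M.polygonSize d :=
  Function.minimalPeriod_apply (M.next.injective.mem_periodicPts d)

theorem vertexDegree_pos (d : M.Dart) : 0 < M.vertexDegree d :=
  Function.minimalPeriod_pos_of_mem_periodicPts (M.rot.injective.mem_periodicPts d)

/-- Two sides are linked if one can pass from one to the other by going around polygons and
crossing edges. -/
def linked (M : OrientedMap.{u}) : Setoid M.Dart where
  r d e := ∃ g ∈ Subgroup.closure ({M.next, M.opp} : Set (Equiv.Perm M.Dart)), g d = e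
  iseqv :=
    { refl := fun _ => ⟨1, one_mem _, rfl⟩
      symm := fun ⟨g, hg, h⟩ => ⟨g⁻¹, inv_mem hg, by rw [← h]; simp⟩
      trans := fun ⟨g, hg, h⟩ ⟨g', hg', h'⟩ => ⟨g' * g, mul_mem hg' hg, by simp [h, h']⟩ }

theorem linked_next (d : M.Dart) : M.linked d (M.next d) :=
  ⟨M.next, Subgroup.subset_closure (by simp), rfl⟩

theorem linked_opp (d : M.Dart) : M.linked d (M.opp d) :=
  ⟨M.opp, Subgroup.subset_closure (by simp), rfl⟩

/-- A property of sides that is invariant under `next` and `opp` is shared by linked sides. -/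
theorem iff_of_linked {p : M.Dart → Prop} (hn : ∀ d, p (M.next d) ↔ p d)
    (ho : ∀ d, p (M.opp d) ↔ p d) {d e : M.Dart} (h : M.linked d e) : p e ↔ p d := by
  obtain ⟨g, hg, rfl⟩ := h
  induction hg using Subgroup.closure_induction generalizing d with
  | mem g hg =>
    rcases hg with rfl | rfl
    · exact hn d
    · exact ho d
  | one => rfl
  | mul g g' _ _ h h' => exact h.trans h'
  | inv g _ h => simpa using (h (d := g⁻¹ d)).symm

/-- The connected component of a side. -/
def component (M : OrientedMap.{u}) (p : M.Dart) : OrientedMap.{u} where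
  Dart := {q // M.linked p q}
  finite := inferInstance
  next := M.next.subtypePerm fun d =>
    ⟨fun h => M.linked.trans' h (M.linked.symm' (linked_next d)),
      fun h => M.linked.trans' h (linked_next d)⟩
  opp := M.opp.subtypePerm fun d =>
    ⟨fun h => M.linked.trans' h (M.linked.symm' (linked_opp d)),
      fun h => M.linked.trans' h (linked_opp d)⟩
  opp_opp d := Subtype.ext (M.opp_opp d)
  opp_ne d h := M.opp_ne d (congrArg Subtype.val h)

theorem component_isConnected (p : M.Dart) : (M.component p).IsConnected := by
  have base : ∀ q : (M.component p).Dart, (M.component p).linked ⟨p, M.linked.refl' p⟩ q := by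
    rintro ⟨q, hq⟩
    -- The invariant property combines membership in the component with being linked to `p` inside
    -- it, so that the whole path from `p` to `q` is lifted to the component.
    have := (iff_of_linked (M := M) (p := fun q => ∃ hq : M.linked p q,
      (M.component p).linked ⟨p, M.linked.refl' p⟩ ⟨q, hq⟩) ?_ ?_ hq).2
      ⟨M.linked.refl' p, Setoid.refl' _ _⟩
    · exact this.2
    · refine fun d => ⟨fun ⟨h, h'⟩ => ?_, fun ⟨h, h'⟩ => ?_⟩
      · have h1 := M.linked.trans' h (M.linked.symm' (linked_next d))
        exact ⟨h1, Setoid.trans' _ h' (Setoid.symm' _ (linked_next (M := M.component p) ⟨d, h1⟩))⟩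
      · exact ⟨M.linked.trans' h (linked_next d),
          Setoid.trans' _ h' (linked_next (M := M.component p) ⟨d, h⟩)⟩
    · refine fun d => ⟨fun ⟨h, h'⟩ => ?_, fun ⟨h, h'⟩ => ?_⟩
      · have h1 := M.linked.trans' h (M.linked.symm' (linked_opp d))
        exact ⟨h1, Setoid.trans' _ h' (Setoid.symm' _ (linked_opp (M := M.component p) ⟨d, h1⟩))⟩
      · exact ⟨M.linked.trans' h (linked_opp d),
          Setoid.trans' _ h' (linked_opp (M := M.component p) ⟨d, h⟩)⟩
  exact ⟨⟨⟨p, M.linked.refl' p⟩⟩, fun d e =>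
    Setoid.trans' _ (Setoid.symm' _ (base d)) (base e)⟩

theorem polygonSize_component (p : M.Dart) (d : (M.component p).Dart) :
    (M.component p).polygonSize d = M.polygonSize d.1 := by
  refine Function.minimalPeriod_eq_minimalPeriod_iff.2 fun n => ?_
  have hs : Function.Semiconj Subtype.val (M.component p).next M.next := fun _ => rfl
  have h := hs.iterate_right n d
  constructor
  · intro h'
    exact h.symm.trans (congrArg Subtype.val h')
  · intro h'
    exact Subtype.ext (h.trans h')

/-- The product of two maps: pairs of sides, with the componentwise operations. -/
def prod (M : OrientedMap.{u}) (N : OrientedMap.{v}) : OrientedMap.{max u v} where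
  Dart := M.Dart × N.Dart
  finite := inferInstance
  next := M.next.prodCongr N.next
  opp := M.opp.prodCongr N.opp
  opp_opp d := Prod.ext (M.opp_opp d.1) (N.opp_opp d.2)
  opp_ne d h := M.opp_ne d.1 (congrArg Prod.fst h)

theorem polygonSize_prod (d : (M.prod N).Dart) :
    (M.prod N).polygonSize d = (M.polygonSize d.1).lcm (N.polygonSize d.2) :=
  Function.minimalPeriod_prodMap M.next N.next d

/-- The fibres of an equivariant map onto a connected map have the same size. -/
theorem card_fiber_eq {f : M.Dart → N.Dart} (hn : ∀ d, f (M.next d) = N.next (f d))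
    (ho : ∀ d, f (M.opp d) = N.opp (f d)) (hN : N.IsConnected) (e e' : N.Dart) :
    Nat.card {d // f d = e} = Nat.card {d // f d = e'} := by
  refine ((iff_of_linked (M := N) (p := fun e' => Nat.card {d // f d = e} =
    Nat.card {d // f d = e'}) (fun x => ?_) (fun x => ?_) (hN.2 e e')).2 rfl)
  · rw [Nat.card_congr (M.next.subtypeEquiv (p := fun d => f d = x)
      (q := fun d => f d = N.next x) fun d => by rw [hn, N.next.apply_eq_iff_eq])]
  · rw [Nat.card_congr (M.opp.subtypeEquiv (p := fun d => f d = x)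
      (q := fun d => f d = N.opp x) fun d => by rw [ho, N.opp.apply_eq_iff_eq])]

/-- Equivariant maps that preserve the sizes of polygons are branched covers. -/
theorem isBranchedCover_of_isConnected {f : M.Dart → N.Dart}
    (hn : ∀ d, f (M.next d) = N.next (f d)) (ho : ∀ d, f (M.opp d) = N.opp (f d))
    (hs : ∀ d, M.polygonSize d = N.polygonSize (f d)) (hN : N.IsConnected) (e : N.Dart) :
    IsBranchedCover M N f (Nat.card {d // f d = e}) :=
  ⟨hn, ho, hs, fun e' => card_fiber_eq hn ho hN e' e⟩

/-- Equivariance under `next` and `opp` gives equivariance under `rot`; branching at a vertex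
multiplies its degree. -/
theorem vertexDegree_dvd {f : M.Dart → N.Dart} (hn : ∀ d, f (M.next d) = N.next (f d))
    (ho : ∀ d, f (M.opp d) = N.opp (f d)) (d : M.Dart) :
    N.vertexDegree (f d) ∣ M.vertexDegree d := by
  have h : Function.Semiconj f M.rot N.rot := fun d => by simp [rot, hn, ho]
  exact ((Function.isPeriodicPt_minimalPeriod M.rot d).map h).minimalPeriod_dvd

/-- The conditions on polygons concern only sizes, which are pulled back, and vertex degrees can
only grow. Connectedness must be assumed, since a cover may be disconnected. -/
theorem IsBranchedCover.isFootballPattern {f : M.Dart → N.Dart} {D : ℕ}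
    (h : IsBranchedCover M N f D) (hM : M.IsConnected) (hN : N.IsFootballPattern) :
    M.IsFootballPattern where
  connected := hM
  three_le_vertexDegree d := (hN.three_le_vertexDegree (f d)).trans
    (Nat.le_of_dvd (vertexDegree_pos d) (vertexDegree_dvd h.map_next h.map_opp d))
  pentagon_or_hexagon d := by
    rw [h.map_polygonSize]
    exact hN.pentagon_or_hexagon _
  pentagon_opp d := by
    rw [h.map_polygonSize, h.map_polygonSize, h.map_opp]
    exact hN.pentagon_opp _
  hexagon_alternate d := by
    rw [h.map_polygonSize, h.map_polygonSize, h.map_polygonSize, h.map_opp, h.map_opp, h.map_next]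
    exact hN.hexagon_alternate _

/-- If `d` and `opp d` both lie on hexagons, alternation makes the side after `d` adjacent to a
pentagon. -/
theorem IsFootballPattern.exists_pentagon (h : M.IsFootballPattern) :
    ∃ d, M.polygonSize d = 5 := by
  obtain ⟨d⟩ := h.connected.1
  have h1 := h.pentagon_or_hexagon d
  have h2 := h.pentagon_or_hexagon (M.opp d)
  have h3 := h.hexagon_alternate d
  by_cases h5 : M.polygonSize d = 5
  · exact ⟨d, h5⟩
  by_cases h6 : M.polygonSize (M.opp d) = 5
  · exact ⟨_, h6⟩
  · exact ⟨M.opp (M.next d), (h3 (by tauto)).2 (by tauto)⟩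

/-- The sides `d` and `e` belong to polygons of the same size and are glued to polygons of the same
size. -/
def SameType (d : M.Dart) (e : N.Dart) : Prop :=
  M.polygonSize d = N.polygonSize e ∧ M.polygonSize (M.opp d) = N.polygonSize (N.opp e)

/-- Only the types (5,6), (6,5) and (6,6) occur, and `next` permutes them: the first is fixed, the
other two are interchanged. -/
theorem IsFootballPattern.sameType_next (hM : M.IsFootballPattern) (hN : N.IsFootballPattern)
    (d : M.Dart) (e : N.Dart) : SameType (M.next d) (N.next e) ↔ SameType d e := by
  have h1 := hM.pentagon_or_hexagon d
  have h2 := hM.pentagon_or_hexagon (M.opp d)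
  have h3 := hM.pentagon_or_hexagon (M.opp (M.next d))
  have h4 := hM.pentagon_opp d
  have h5 := hM.pentagon_opp (M.next d)
  have h6 := hM.hexagon_alternate d
  have k1 := hN.pentagon_or_hexagon e
  have k2 := hN.pentagon_or_hexagon (N.opp e)
  have k3 := hN.pentagon_or_hexagon (N.opp (N.next e))
  have k4 := hN.pentagon_opp e
  have k5 := hN.pentagon_opp (N.next e)
  have k6 := hN.hexagon_alternate e
  unfold SameType
  rw [polygonSize_next] at *
  rw [polygonSize_next] at *
  omega

theorem sameType_opp (d : M.Dart) (e : N.Dart) : SameType (M.opp d) (N.opp e) ↔ SameType d e := by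
  unfold SameType
  rw [M.opp_opp, N.opp_opp]
  exact and_comm

/-- Two football patterns, with pentagons `d` and `e`, have a common branched cover whose degree
over the first one is at most the number of pentagonal sides of the second one. -/
theorem IsFootballPattern.exists_common_cover (hM : M.IsFootballPattern)
    (hN : N.IsFootballPattern) :
    ∃ Q : OrientedMap.{max u v}, Q.IsFootballPattern ∧
      ∃ D ≤ Nat.card {e // N.polygonSize e = 5}, Q.BranchedCovers M D ∧
        ∃ E, Q.BranchedCovers N E := by
  obtain ⟨d, hd⟩ := hM.exists_pentagon
  obtain ⟨e, he⟩ := hN.exists_pentagon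
  let Q := (M.prod N).component (d, e)
  have hT : ∀ q : Q.Dart, SameType q.1.1 q.1.2 := by
    rintro ⟨q, hq⟩
    refine (iff_of_linked (M := M.prod N) (p := fun q => SameType q.1 q.2)
      (fun q => hM.sameType_next hN q.1 q.2) (fun q => sameType_opp q.1 q.2) hq).2 ?_
    exact ⟨hd.trans he.symm, (hM.pentagon_opp d hd).trans (hN.pentagon_opp e he).symm⟩
  have hs : ∀ q : Q.Dart, Q.polygonSize q = (M.polygonSize q.1.1).lcm (N.polygonSize q.1.2) :=
    fun q => (polygonSize_component _ q).trans (polygonSize_prod q.1)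
  have h1 := isBranchedCover_of_isConnected (M := Q) (N := M) (f := fun q => q.1.1)
    (fun _ => rfl) (fun _ => rfl) (fun q => by rw [hs, ← (hT q).1, Nat.lcm_self]) hM.connected d
  have h2 := isBranchedCover_of_isConnected (M := Q) (N := N) (f := fun q => q.1.2)
    (fun _ => rfl) (fun _ => rfl) (fun q => by rw [hs, (hT q).1, Nat.lcm_self]) hN.connected e
  refine ⟨Q, h1.isFootballPattern (component_isConnected _) hM, _, ?_, ⟨_, h1⟩, _, ⟨_, h2⟩⟩
  -- In the fibre over `d` the first coordinate is fixed, so the second one determines the pair; it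
  -- is pentagonal because types agree.
  refine Nat.card_le_card_of_injective
    (fun q => (⟨q.1.1.2, by rw [← (hT q.1).1, q.2, hd]⟩ : {e // N.polygonSize e = 5})) ?_
  intro q q' h
  exact Subtype.ext (Subtype.ext (Prod.ext (q.2.trans q'.2.symm) (congrArg Subtype.val h)))

end OrientedMap

/-! ### Transitivity on arcs and on pairs of arcs -/

namespace Icosahedron

open Vertex

/-- One can pass from any arc to any other one by turning about vertices and triangles. -/
theorem connected (r : Setoid Arc) (h₁ : ∀ a, r a (turn a)) (h₂ : ∀ a, r a (triangle a))
    (a b : Arc) : r a b := by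
  have hrev : ∀ a, r a (reverse a) := fun a => by
    have h := h₁ (triangle a)
    rw [show turn (triangle a) = reverse a from turn.apply_symm_apply _] at h
    exact r.trans' (h₂ a) h
  have hturn : ∀ p (i j : Fin 5), r (p, i) (p, j) := by
    intro p
    have hn : ∀ (n : ℕ) (i : Fin 5), r (p, i) (turn^[n] (p, i)) := fun n i => by
      induction n with
      | zero => exact r.refl' _
      | succ n ih =>
        rw [Function.iterate_succ_apply']
        exact r.trans' ih (h₁ _)
    intro i j
    have h : ∀ p, ∀ i j : Fin 5, turn^[(j - i).val] (p, i) = (p, j) := by decide +kernel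
    rw [← h p i j]
    exact hn _ i
  have hmove : ∀ (a b : Arc) (i : Fin 5), r a (b.1, i) → r a b :=
    fun a b i h => r.trans' h (hturn b.1 i b.2)
  -- Walk along edges from the north pole to the upper ring, the lower ring and the south pole.
  have base : ∀ b, r (north, 0) b := by
    have hu : ∀ i, ∀ j, r (north, 0) (upper i, j) := fun i j =>
      hmove _ _ 0 (r.trans' (hturn north 0 i) (hrev (north, i)))
    have hl : ∀ i, ∀ j, r (north, 0) (lower i, j) := fun i j =>
      hmove _ _ 1 (r.trans' (hu i 3) (hrev (upper i, 3)))
    rintro ⟨p | p | i | i, j⟩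
    · exact hturn _ _ _
    · exact hmove _ _ 0 (r.trans' (hl 0 3) (hrev (lower 0, 3)))
    · exact hu i j
    · exact hl i j
  exact r.trans' (r.symm' (base a)) (base b)

/-- `reverse` as a permutation. -/
def reversePerm : Equiv.Perm Arc := ⟨reverse, reverse, reverse_reverse, reverse_reverse⟩

/-- The operation on arcs that is performed by the twisted football when the standard one performs
`reverse`. -/
def twistedReverse : Equiv.Perm Arc := triangle.symm * reversePerm * triangle

/-- A word in `turn`, `triangle` and `reverse` that is trivial on the twisted football. -/
def shift : Equiv.Perm Arc := reversePerm * (triangle.symm * turn * triangle * triangle).symm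

/-- `shift` and its conjugate by `turn` have order five, so exponents in `Fin 5` cover all their
powers; alternating words with four factors already reach all 60 arcs. -/
theorem shift_transitive : ∀ b, ∃ i j k l : Fin 5,
    shift^[l] ((turn * shift * turn.symm)^[k] (shift^[j]
      ((turn * shift * turn.symm)^[i] (Vertex.north, 0)))) = b := by
  decide +kernel

/-- Since `turn * triangle` is `reverse`, the inverted word is `reverse` conjugated by `triangle`,
that is, `twistedReverse`, an involution. -/
theorem twistedReverse_mul :
    ∀ a, twistedReverse ((triangle.symm * turn * triangle * triangle).symm a) = a := by
  decide +kernel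

theorem triangle_triangle_triangle : ∀ a, triangle (triangle (triangle a)) = a := by
  decide +kernel

theorem triangle_ne : ∀ a, triangle a ≠ a := by
  decide +kernel

theorem turn_iterate_five (a : Arc) : turn^[5] a = a := by
  revert a
  decide +kernel

/-- A set of pairs of arcs that is invariant under the simultaneous operations on pairs of arcs of
the twisted and the standard football is empty or contains all pairs. -/
theorem forall_pair {p : Arc → Arc → Prop} (h₁ : ∀ a b, p a b → p (turn a) (turn b))
    (h₂ : ∀ a b, p a b → p (triangle a) (triangle b))
    (h₃ : ∀ a b, p a b → p (twistedReverse a) (reverse b)) {a₀ b₀ : Arc} (h₀ : p a₀ b₀)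
    (a b : Arc) : p a b := by
  -- A subset of a finite set that a permutation maps into itself is also invariant under the
  -- inverse.
  have symm : ∀ σ τ : Equiv.Perm Arc, (∀ a b, p a b → p (σ a) (τ b)) →
      ∀ a b, p a b → p (σ.symm a) (τ.symm b) := fun σ τ h a b hab =>
    Equiv.Perm.perm_symm_on_of_perm_on_finite (f := σ.prodCongr τ) (p := fun x => p x.1 x.2)
      (fun x hx => h x.1 x.2 hx) (x := (a, b)) hab
  have h₁' := symm _ _ h₁
  have h₂' := symm _ _ h₂
  -- The same word acts trivially on the first arc and as `shift` on the second.
  have hs : ∀ a b, p a b → p a (shift b) := fun a b h => by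
    have h' := h₃ _ _ (h₂' _ _ (h₂' _ _ (h₁' _ _ (h₂ _ _ h))))
    rw [← twistedReverse_mul a]
    exact h'
  have hc : ∀ a b, p a b → p a ((turn * shift * turn.symm) b) := fun a b h => by
    have h' := h₁ _ _ (hs _ _ (h₁' _ _ h))
    rwa [turn.apply_symm_apply] at h'
  have iter : ∀ (σ : Equiv.Perm Arc), (∀ a b, p a b → p a (σ b)) →
      ∀ (n : ℕ) a b, p a b → p a (σ^[n] b) := fun σ h n a b hab => by
    induction n with
    | zero => exact hab
    | succ n ih =>
      rw [Function.iterate_succ_apply']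
      exact h _ _ ih
  have hinv : ∀ a (σ : Equiv.Perm Arc), (∀ a b, p a b → p a (σ b)) → ∀ b, p a (σ b) → p a b :=
    fun a σ h b hb => by
      have h' := symm 1 σ h a (σ b) hb
      rwa [σ.symm_apply_apply] at h'
  have iter' : ∀ (σ : Equiv.Perm Arc), (∀ a b, p a b → p a (σ b)) →
      ∀ (n : ℕ) a b, p a (σ^[n] b) → p a b := fun σ h n a b hab => by
    induction n with
    | zero => exact hab
    | succ n ih =>
      rw [Function.iterate_succ_apply'] at hab
      exact ih (hinv _ _ h _ hab)
  -- Go back from `b` to `(north, 0)`, then forward to `b'`, keeping `a` fixed.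
  have all : ∀ a b, p a b → ∀ b', p a b' := fun a b h b' => by
    obtain ⟨i, j, k, l, rfl⟩ := shift_transitive b
    obtain ⟨i', j', k', l', rfl⟩ := shift_transitive b'
    exact iter _ hs _ _ _ (iter _ hc _ _ _ (iter _ hs _ _ _ (iter _ hc _ _ _
      (iter' _ hc _ _ _ (iter' _ hs _ _ _ (iter' _ hc _ _ _ (iter' _ hs _ _ _ h)))))))
  -- Having some partner is invariant under `turn` and `triangle`, hence shared by all first arcs.
  let r : Setoid Arc :=
    { r := fun a a' => (∃ b, p a b) ↔ ∃ b, p a' b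
      iseqv := ⟨fun _ => Iff.rfl, Iff.symm, Iff.trans⟩ }
  have hr := (connected r
    (fun a => ⟨fun ⟨b, h⟩ => ⟨_, h₁ _ _ h⟩, fun ⟨b, h⟩ => ⟨_, by simpa using h₁' _ _ h⟩⟩)
    (fun a => ⟨fun ⟨b, h⟩ => ⟨_, h₂ _ _ h⟩, fun ⟨b, h⟩ => ⟨_, by simpa using h₂' _ _ h⟩⟩) a₀ a).1
    ⟨b₀, h₀⟩
  exact all a _ hr.choose_spec b

/-! ### The rotations of the icosahedron -/

/-- The rotation of the icosahedron about its poles. -/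
def polarRotation : Arc → Arc
  | (north, j) => (north, j + 1)
  | (south, j) => (south, j - 1)
  | (upper i, j) => (upper (i + 1), j)
  | (lower i, j) => (lower (i + 1), j)

/-- The rotation of the icosahedron that interchanges `upper i` and `lower (-i)`. -/
def equatorialRotation : Arc → Arc
  | (north, j) => (south, j)
  | (south, j) => (north, j)
  | (upper i, j) => (lower (-i), j + 3)
  | (lower i, j) => (upper (-i), j + 2)

/-- The rotation of the icosahedron about the edge from `north` to `upper 0`. -/
def edgeRotation : Arc → Arc
  | (north, j) => (upper 0, j)
  | (south, j) => (lower 2, j)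
  | (upper 0, j) => (north, j)
  | (upper 1, j) => (upper 4, j + 4)
  | (upper 2, j) => (lower 4, j)
  | (upper 3, j) => (lower 0, j + 1)
  | (upper 4, j) => (upper 1, j + 1)
  | (lower 0, j) => (upper 3, j + 4)
  | (lower 1, j) => (lower 3, j + 4)
  | (lower 2, j) => (south, j)
  | (lower 3, j) => (lower 1, j + 1)
  | (lower 4, j) => (upper 2, j)

/-- The rotations of the icosahedron, as maps of arcs. -/
def IsRotation (φ : Arc → Arc) : Prop :=
  (∀ a, φ (turn a) = turn (φ a)) ∧ ∀ a, φ (reverse a) = reverse (φ a)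

theorem IsRotation.comp {φ ψ : Arc → Arc} (hφ : IsRotation φ) (hψ : IsRotation ψ) :
    IsRotation (φ ∘ ψ) :=
  ⟨fun a => by simp [hφ.1, hψ.1], fun a => by simp [hφ.2, hψ.2]⟩

theorem IsRotation.iterate {φ : Arc → Arc} (hφ : IsRotation φ) (n : ℕ) : IsRotation φ^[n] := by
  induction n with
  | zero => exact ⟨fun _ => rfl, fun _ => rfl⟩
  | succ n ih => exact ih.comp hφ

theorem IsRotation.triangle {φ : Arc → Arc} (hφ : IsRotation φ) (a : Arc) :
    φ (triangle a) = triangle (φ a) := by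
  apply turn.injective
  rw [← hφ.1]
  change φ (turn (turn.symm _)) = turn (turn.symm _)
  rw [turn.apply_symm_apply, turn.apply_symm_apply, hφ.2]

/-- The image is non-empty and invariant under `turn`, `triangle` and their inverses, so
connectedness makes it everything. -/
theorem IsRotation.surjective {φ : Arc → Arc} (hφ : IsRotation φ) : Function.Surjective φ := by
  let r : Setoid Arc :=
    { r := fun a b => (∃ c, φ c = a) ↔ ∃ c, φ c = b
      iseqv := ⟨fun _ => Iff.rfl, Iff.symm, Iff.trans⟩ }
  refine fun b => (connected r (fun a => ⟨?_, ?_⟩) (fun a => ⟨?_, ?_⟩) (φ b) b).1 ⟨b, rfl⟩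
  · rintro ⟨c, rfl⟩
    exact ⟨_, hφ.1 c⟩
  · rintro ⟨c, hc⟩
    exact ⟨turn.symm c, turn.injective (by rw [← hφ.1, turn.apply_symm_apply, hc])⟩
  · rintro ⟨c, rfl⟩
    exact ⟨_, hφ.triangle c⟩
  · rintro ⟨c, hc⟩
    exact ⟨Icosahedron.triangle.symm c,
      Icosahedron.triangle.injective (by rw [← hφ.triangle, Equiv.apply_symm_apply, hc])⟩

theorem isRotation_polarRotation : IsRotation polarRotation := by
  unfold IsRotation
  decide +kernel

theorem isRotation_equatorialRotation : IsRotation equatorialRotation := by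
  unfold IsRotation
  decide +kernel

theorem isRotation_edgeRotation : IsRotation edgeRotation := by
  unfold IsRotation
  decide +kernel

/-- The exponent `k` selects the arc at its initial vertex, `s` and `e` move this vertex to a pole
or to one of the two rings, and `i` turns it to its place in the ring. -/
theorem exists_rotation_iterate : ∀ a, ∃ i k : Fin 5, ∃ e s : Fin 2,
    polarRotation^[i] (equatorialRotation^[e] (edgeRotation^[s]
      (polarRotation^[k] (north, 0)))) = a := by
  decide +kernel

theorem exists_isRotation (a b : Arc) : ∃ φ : Equiv.Perm Arc, IsRotation φ ∧ φ a = b := by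
  have base : ∀ a, ∃ φ : Equiv.Perm Arc, IsRotation φ ∧ φ (north, 0) = a := fun a => by
    obtain ⟨i, k, e, s, h⟩ := exists_rotation_iterate a
    have hφ := (isRotation_polarRotation.iterate i).comp
      ((isRotation_equatorialRotation.iterate e).comp
        ((isRotation_edgeRotation.iterate s).comp (isRotation_polarRotation.iterate k)))
    exact ⟨Equiv.ofBijective _ (Finite.surjective_iff_bijective.1 hφ.surjective), hφ, h⟩
  obtain ⟨φ, hφ, rfl⟩ := base a
  obtain ⟨ψ, hψ, rfl⟩ := base b
  refine ⟨φ.symm.trans ψ, ⟨fun a => ?_, fun a => ?_⟩, by simp⟩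
  · obtain ⟨c, rfl⟩ := φ.surjective a
    rw [← hφ.1]
    simp [hψ.1]
  · obtain ⟨c, rfl⟩ := φ.surjective a
    rw [← hφ.2]
    simp [hψ.2]

end Icosahedron

/-! ### Periods and numbers of sides -/

theorem minimalPeriod_eq_six {α : Type*} {f : α → α} {x : α} (h : f^[6] x = x) (h₂ : f^[2] x ≠ x)
    (h₃ : f^[3] x ≠ x) : Function.minimalPeriod f x = 6 := by
  have h6 : Function.minimalPeriod f x ∣ 6 := Function.IsPeriodicPt.minimalPeriod_dvd h
  have h2 : ¬ Function.minimalPeriod f x ∣ 2 := fun h' =>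
    h₂ (Function.isPeriodicPt_iff_minimalPeriod_dvd.2 h')
  have h3 : ¬ Function.minimalPeriod f x ∣ 3 := fun h' =>
    h₃ (Function.isPeriodicPt_iff_minimalPeriod_dvd.2 h')
  have := Nat.le_of_dvd (by norm_num) h6
  generalize Function.minimalPeriod f x = n at *
  interval_cases n <;> omega

theorem minimalPeriod_eq_fifteen {α : Type*} {f : α → α} {x : α} (h : f^[15] x = x)
    (h₃ : f^[3] x ≠ x) (h₅ : f^[5] x ≠ x) : Function.minimalPeriod f x = 15 := by
  have h15 : Function.minimalPeriod f x ∣ 15 := Function.IsPeriodicPt.minimalPeriod_dvd h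
  have h3 : ¬ Function.minimalPeriod f x ∣ 3 := fun h' =>
    h₃ (Function.isPeriodicPt_iff_minimalPeriod_dvd.2 h')
  have h5 : ¬ Function.minimalPeriod f x ∣ 5 := fun h' =>
    h₅ (Function.isPeriodicPt_iff_minimalPeriod_dvd.2 h')
  have := Nat.le_of_dvd (by norm_num) h15
  generalize Function.minimalPeriod f x = n at *
  interval_cases n <;> omega

theorem minimalPeriod_eq_five {α : Type*} {f : α → α} {x : α} (h : f^[5] x = x) (h₁ : f x ≠ x) :
    Function.minimalPeriod f x = 5 :=
  have : Fact (Nat.Prime 5) := ⟨by norm_num⟩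
  Function.minimalPeriod_eq_prime h h₁

namespace FootballSide

theorem card_eq : Nat.card FootballSide = 180 := by
  rw [Nat.card_eq_fintype_card]
  decide +kernel

/-- The pentagonal sides are indexed by arcs. -/
theorem card_pent {p : FootballSide → Prop} (h₁ : ∀ a, p (pent a)) (h₂ : ∀ a, ¬ p (corner a))
    (h₃ : ∀ a, ¬ p (edge a)) : Nat.card {s // p s} = 60 := by
  have h : Nat.card Arc = 60 := by
    rw [Nat.card_eq_fintype_card]
    decide +kernel
  rw [← h]
  refine (Nat.card_eq_of_bijective (fun a => ⟨pent a, h₁ a⟩) ⟨fun a b hab => ?_, ?_⟩).symm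
  · exact FootballSide.pent.inj (congrArg Subtype.val hab)
  · rintro ⟨a | a | a, ha⟩
    · exact ⟨a, rfl⟩
    · exact absurd ha (h₂ a)
    · exact absurd ha (h₃ a)

/-- The sides of hexagons are the remaining ones. -/
theorem card_not_pent {p : FootballSide → Prop} (h₁ : ∀ a, ¬ p (pent a)) (h₂ : ∀ a, p (corner a))
    (h₃ : ∀ a, p (edge a)) : Nat.card {s // p s} = 120 := by
  classical
  have h := card_pent (p := fun s => ¬ p s) h₁ (fun a h => h (h₂ a)) (fun a h => h (h₃ a))
  have hc := Nat.card_congr (Equiv.sumCompl p)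
  rw [Nat.card_sum, h, card_eq] at hc
  omega

end FootballSide

open FootballSide

/-! ### Polygon counts, vertex degrees and genera of the two footballs -/

namespace OrientedMap

/-- The numbers of polygons of a map whose polygons are pentagons and hexagons. -/
theorem card_polygon_eq {M : OrientedMap.{u}} (h : ∀ d, M.polygonSize d = 5 ∨ M.polygonSize d = 6) :
    Nat.card M.Polygon = M.numPolygons 5 + M.numPolygons 6 := by
  classical
  let p : M.Polygon → Prop := fun F => ∃ d, M.polygonOf d = F ∧ M.polygonSize d = 5
  have : Finite M.Polygon := Quotient.finite _
  have hc := Nat.card_congr (Equiv.sumCompl p)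
  rw [Nat.card_sum] at hc
  rw [← hc]
  congr 1
  refine Nat.card_congr (Equiv.subtypeEquivRight fun F => ⟨?_, ?_⟩)
  · obtain ⟨d, rfl⟩ := Quotient.exists_rep F
    exact fun hF => ⟨d, rfl, (h d).resolve_left fun h5 => hF ⟨d, rfl, h5⟩⟩
  -- The size is constant along a cycle of `next`, so no polygon is counted twice.
  · rintro ⟨d, rfl, h6⟩ ⟨e, he, h5⟩
    have hde : M.next.SameCycle e d := Quotient.exact he
    obtain ⟨n, rfl⟩ := hde.exists_nat_pow_eq
    have hn : M.polygonSize ((M.next ^ n) e) = M.polygonSize e := by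
      rw [Equiv.Perm.coe_pow]
      exact Function.minimalPeriod_apply_iterate (M.next.injective.mem_periodicPts e) n
    omega

theorem numPolygons_mul (M : OrientedMap.{u}) (k : ℕ) :
    M.numPolygons k * k = Nat.card {d // M.polygonSize d = k} :=
  M.next.card_cycles_mul_period k

theorem card_vertex_mul {M : OrientedMap.{u}} {k : ℕ} (h : ∀ d, M.vertexDegree d = k) :
    Nat.card M.Vertex * k = Nat.card M.Dart :=
  M.rot.card_quotient_sameCycle_mul k h

theorem card_edge_mul (M : OrientedMap.{u}) : Nat.card M.Edge * 2 = Nat.card M.Dart :=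
  M.opp.card_quotient_sameCycle_mul 2 fun d =>
    have : Fact (Nat.Prime 2) := ⟨Nat.prime_two⟩
    Function.minimalPeriod_eq_prime (M.opp_opp d) (M.opp_ne d)

/-- A map on the sides of the standard football with the same gluing, for which the sides `pent a`
belong to pentagons and the others to hexagons, is a football pattern if it is connected and its
vertices have degree at least three. -/
theorem isFootballPattern_of_sizes {n : Equiv.Perm FootballSide} {M : OrientedMap.{0}}
    (hM : M = ⟨FootballSide, inferInstance, n, oppPerm, FootballSide.opp_opp,
      FootballSide.opp_ne⟩)
    (hpent : ∀ a, Function.minimalPeriod n (pent a) = 5)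
    (hcorner : ∀ a, Function.minimalPeriod n (corner a) = 6)
    (hedge : ∀ a, Function.minimalPeriod n (edge a) = 6)
    (hce : ∀ a, ∃ b, n (corner a) = edge b) (hec : ∀ a, ∃ b, n (edge a) = corner b)
    (hconn : M.IsConnected) (hdeg : ∀ d, 3 ≤ M.vertexDegree d) : M.IsFootballPattern := by
  subst hM
  refine ⟨hconn, hdeg, ?_, ?_, ?_⟩ <;> rintro (a | a | a)
  · exact .inl (hpent a)
  · exact .inr (hcorner a)
  · exact .inr (hedge a)
  · exact fun _ => hcorner a
  · exact fun h => absurd ((hcorner a).symm.trans h) (by norm_num)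
  · exact fun h => absurd ((hedge a).symm.trans h) (by norm_num)
  · exact fun h => absurd ((hpent a).symm.trans h) (by norm_num)
  · obtain ⟨b, hb⟩ := hce a
    refine fun _ => iff_of_false (fun h => ?_) fun h => ?_
    · change Function.minimalPeriod n (FootballSide.opp (n (corner a))) = 5 at h
      rw [hb] at h
      exact absurd ((hedge _).symm.trans h) (by norm_num)
    · exact absurd ((hpent a).symm.trans h) (by norm_num)
  · obtain ⟨b, hb⟩ := hec a
    refine fun _ => iff_of_true ?_ (hedge _)
    change Function.minimalPeriod n (FootballSide.opp (n (edge a))) = 5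
    rw [hb]
    exact hpent b

/-- The Euler characteristic of a map with 180 sides of pentagons and hexagons, among them 60 sides
of pentagons, all of whose vertices have the same degree. -/
theorem hasGenus_of_sizes {M : OrientedMap.{u}} {g k v : ℕ} (hM : M.IsFootballPattern)
    (hcard : Nat.card M.Dart = 180) (h5 : M.numPolygons 5 = 12) (h6 : M.numPolygons 6 = 20)
    (hk : ∀ d, M.vertexDegree d = k) (hv : v * k = 180) (hg : 2 * g + v = 60) : M.HasGenus g := by
  refine ⟨hM.connected, ?_⟩
  have h1 := card_polygon_eq hM.pentagon_or_hexagon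
  have h2 := card_vertex_mul hk
  have h3 := M.card_edge_mul
  have h4 : Nat.card M.Vertex = v := by
    have hk0 : 0 < k := Nat.pos_of_ne_zero (by rintro rfl; omega)
    exact Nat.eq_of_mul_eq_mul_right hk0 (by omega)
  unfold eulerChar
  -- There are 90 edges and 32 polygons, so the Euler characteristic is `v - 58`.
  omega

end OrientedMap

open OrientedMap

theorem FootballSide.next_pent_size (n : Equiv.Perm FootballSide)
    (h : ∀ a, n (pent a) = pent (turn a)) (a : Arc) : Function.minimalPeriod n (pent a) = 5 := by
  have hs : Function.Semiconj pent turn n := fun a => (h a).symm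
  refine minimalPeriod_eq_five ?_ ?_
  · rw [← hs.iterate_right 5 a, turn_iterate_five]
  · rw [h]
    intro h'
    have := congrArg Prod.snd (pent.inj h')
    simp [turn] at this

theorem standardFootball_polygonSize_pent (a : Arc) :
    standardFootball.polygonSize (pent a) = 5 :=
  FootballSide.next_pent_size FootballSide.next (fun _ => rfl) a

theorem twistedFootball_polygonSize_pent (a : Arc) :
    twistedFootball.polygonSize (pent a) = 5 :=
  FootballSide.next_pent_size FootballSide.twistedNext (fun _ => rfl) a

/-- Two steps around a hexagon apply `triangle`, of order three, and an odd number of steps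
exchanges `corner` and `edge`. The same reason serves the next three lemmas. -/
theorem standardFootball_polygonSize_corner (a : Arc) :
    standardFootball.polygonSize (corner a) = 6 :=
  minimalPeriod_eq_six (congrArg corner (triangle_triangle_triangle a))
    (fun h => triangle_ne a (corner.inj h)) (fun h => FootballSide.noConfusion h)

theorem standardFootball_polygonSize_edge (a : Arc) :
    standardFootball.polygonSize (edge a) = 6 :=
  minimalPeriod_eq_six (congrArg edge (triangle_triangle_triangle a))
    (fun h => triangle_ne a (edge.inj h)) (fun h => FootballSide.noConfusion h)

theorem twistedFootball_polygonSize_corner (a : Arc) :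
    twistedFootball.polygonSize (corner a) = 6 :=
  minimalPeriod_eq_six (congrArg corner (triangle_triangle_triangle a))
    (fun h => triangle_ne a (corner.inj h)) (fun h => FootballSide.noConfusion h)

theorem twistedFootball_polygonSize_edge (a : Arc) :
    twistedFootball.polygonSize (edge a) = 6 :=
  minimalPeriod_eq_six (congrArg edge (triangle_triangle_triangle a))
    (fun h => triangle_ne a (edge.inj h)) (fun h => FootballSide.noConfusion h)

/-- A map on the sides of the standard football is connected if the arcs of the icosahedron are
linked by turning about vertices and triangles. -/
theorem isConnected_of_linked {M : OrientedMap.{u}} (pent' corner' edge' : Arc → M.Dart)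
    (hM : ∀ d, (∃ a, d = pent' a) ∨ (∃ a, d = corner' a) ∨ ∃ a, d = edge' a)
    (hcorner : ∀ a, M.linked (pent' a) (corner' a))
    (hedge : ∀ a, ∃ b, M.linked (corner' b) (edge' a))
    (hturn : ∀ a, M.linked (pent' a) (pent' (turn a)))
    (htriangle : ∀ a, M.linked (corner' a) (corner' (triangle a))) : M.IsConnected := by
  have hpent : ∀ a b, M.linked (pent' a) (pent' b) :=
    connected (M.linked.comap pent') hturn fun a => M.linked.trans' (hcorner a)
      (M.linked.trans' (htriangle a) (M.linked.symm' (hcorner _)))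
  have base : ∀ d, M.linked (pent' (Vertex.north, 0)) d := fun d => by
    obtain ⟨a, rfl⟩ | ⟨a, rfl⟩ | ⟨a, rfl⟩ := hM d
    · exact hpent _ a
    · exact M.linked.trans' (hpent _ a) (hcorner a)
    · obtain ⟨b, hb⟩ := hedge a
      exact M.linked.trans' (hpent _ b) (M.linked.trans' (hcorner b) hb)
  exact ⟨⟨pent' (Vertex.north, 0)⟩, fun d e =>
    M.linked.trans' (M.linked.symm' (base d)) (base e)⟩

theorem FootballSide.cases_dart (d : FootballSide) :
    (∃ a, d = pent a) ∨ (∃ a, d = corner a) ∨ ∃ a, d = edge a := by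
  cases d <;> simp

theorem standardFootball_isConnected : standardFootball.IsConnected :=
  isConnected_of_linked (M := standardFootball) pent corner edge FootballSide.cases_dart
    (fun a => linked_opp (M := standardFootball) (pent a))
    (fun a => ⟨a, linked_next (M := standardFootball) (corner a)⟩)
    (fun a => linked_next (M := standardFootball) (pent a))
    (fun a => Setoid.trans' _ (linked_next (M := standardFootball) (corner a))
      (linked_next (M := standardFootball) (edge a)))

theorem twistedFootball_isConnected : twistedFootball.IsConnected :=
  isConnected_of_linked (M := twistedFootball) pent corner edge FootballSide.cases_dart
    (fun a => linked_opp (M := twistedFootball) (pent a))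
    (fun a => ⟨a, Setoid.symm' _ (linked_next (M := twistedFootball) (edge a))⟩)
    (fun a => linked_next (M := twistedFootball) (pent a))
    (fun a => Setoid.trans' _ (linked_next (M := twistedFootball) (corner a))
      (linked_next (M := twistedFootball) (edge (triangle a))))

/-- Three rotations send `pent a` to `pent (turn (triangle (reverse a)))`, which is `pent a` because
`turn * triangle` is `reverse`. -/
theorem standardFootball_vertexDegree (d : FootballSide) :
    standardFootball.vertexDegree d = 3 := by
  have : Fact (Nat.Prime 3) := ⟨Nat.prime_three⟩
  have h : ∀ d : FootballSide, (FootballSide.next * oppPerm)^[3] d = d ∧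
      (FootballSide.next * oppPerm) d ≠ d := by
    decide +kernel
  exact Function.minimalPeriod_eq_prime (h d).1 (h d).2

/-- Three rotations send `pent a` to `pent (turn (reverse (triangle a)))`. This operation on arcs is
a commutator of `turn` and `reverse`, and has order five. -/
theorem twistedFootball_vertexDegree (d : FootballSide) :
    twistedFootball.vertexDegree d = 15 := by
  have h : ∀ d : FootballSide, (twistedNext * oppPerm)^[15] d = d ∧
      (twistedNext * oppPerm)^[3] d ≠ d ∧ (twistedNext * oppPerm)^[5] d ≠ d := by
    decide +kernel
  exact minimalPeriod_eq_fifteen (h d).1 (h d).2.1 (h d).2.2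

theorem standardFootball_isFootballPattern : standardFootball.IsFootballPattern :=
  isFootballPattern_of_sizes rfl standardFootball_polygonSize_pent
    standardFootball_polygonSize_corner standardFootball_polygonSize_edge
    (fun a => ⟨a, rfl⟩) (fun a => ⟨triangle a, rfl⟩) standardFootball_isConnected
    (fun d => (standardFootball_vertexDegree d).ge)

theorem twistedFootball_isFootballPattern : twistedFootball.IsFootballPattern :=
  isFootballPattern_of_sizes rfl twistedFootball_polygonSize_pent
    twistedFootball_polygonSize_corner twistedFootball_polygonSize_edge
    (fun a => ⟨triangle a, rfl⟩) (fun a => ⟨a, rfl⟩) twistedFootball_isConnected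
    (fun d => (by norm_num : 3 ≤ 15).trans (twistedFootball_vertexDegree d).ge)

theorem standardFootball_card_pentagonal :
    Nat.card {e // standardFootball.polygonSize e = 5} = 60 :=
  card_pent (p := fun s => standardFootball.polygonSize s = 5) standardFootball_polygonSize_pent
    (fun a => by rw [standardFootball_polygonSize_corner]; norm_num)
    (fun a => by rw [standardFootball_polygonSize_edge]; norm_num)

theorem standardFootball_numPolygons_five : standardFootball.numPolygons 5 = 12 := by
  have h := standardFootball.numPolygons_mul 5
  rw [standardFootball_card_pentagonal] at h
  omega

theorem standardFootball_numPolygons_six : standardFootball.numPolygons 6 = 20 := by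
  have h := standardFootball.numPolygons_mul 6
  have h' := card_not_pent (p := fun s => standardFootball.polygonSize s = 6)
    (fun a => by rw [standardFootball_polygonSize_pent]; norm_num)
    standardFootball_polygonSize_corner standardFootball_polygonSize_edge
  have := h.trans h'
  omega

theorem twistedFootball_numPolygons_five : twistedFootball.numPolygons 5 = 12 := by
  have h := twistedFootball.numPolygons_mul 5
  have h' := card_pent (p := fun s => twistedFootball.polygonSize s = 5)
    twistedFootball_polygonSize_pent
    (fun a => by rw [twistedFootball_polygonSize_corner]; norm_num)
    (fun a => by rw [twistedFootball_polygonSize_edge]; norm_num)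
  have := h.trans h'
  omega

theorem twistedFootball_numPolygons_six : twistedFootball.numPolygons 6 = 20 := by
  have h := twistedFootball.numPolygons_mul 6
  have h' := card_not_pent (p := fun s => twistedFootball.polygonSize s = 6)
    (fun a => by rw [twistedFootball_polygonSize_pent]; norm_num)
    twistedFootball_polygonSize_corner twistedFootball_polygonSize_edge
  have := h.trans h'
  omega

theorem standardFootball_hasGenus : standardFootball.HasGenus 0 :=
  hasGenus_of_sizes (v := 60) standardFootball_isFootballPattern FootballSide.card_eq
    standardFootball_numPolygons_five standardFootball_numPolygons_six
    standardFootball_vertexDegree rfl rfl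

theorem twistedFootball_hasGenus : twistedFootball.HasGenus 24 :=
  hasGenus_of_sizes (v := 12) twistedFootball_isFootballPattern FootballSide.card_eq
    twistedFootball_numPolygons_five twistedFootball_numPolygons_six
    twistedFootball_vertexDegree rfl rfl

/-! ### Symmetry of the twisted football -/

/-- The action of a permutation of the arcs on the sides of the football. -/
def FootballSide.map (φ : Equiv.Perm Arc) : Equiv.Perm FootballSide where
  toFun
    | pent a => pent (φ a)
    | corner a => corner (φ a)
    | edge a => edge (φ a)
  invFun
    | pent a => pent (φ.symm a)
    | corner a => corner (φ.symm a)
    | edge a => edge (φ.symm a)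
  left_inv s := by cases s <;> simp
  right_inv s := by cases s <;> simp

/-- The twisted order and the gluing are expressed by `turn`, `triangle` and `reverse`, all of which
commute with rotations. -/
theorem twistedFootball_isAut_map {φ : Equiv.Perm Arc} (hφ : IsRotation φ) :
    twistedFootball.IsAut (FootballSide.map φ) := by
  constructor <;> rintro (a | a | a)
  · exact congrArg pent (hφ.1 a)
  · exact congrArg edge (hφ.triangle a)
  · rfl
  · rfl
  · rfl
  · exact congrArg edge (hφ.2 a)

theorem twistedFootball_isSymmetricFootball : twistedFootball.IsSymmetricFootball := by
  refine ⟨twistedFootball_isFootballPattern, ?_, ?_, ?_⟩ <;> rintro (a | a | a)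
  · intro _
    obtain ⟨φ, hφ, h⟩ := exists_isRotation a (turn a)
    exact ⟨FootballSide.map φ, twistedFootball_isAut_map hφ, congrArg pent h⟩
  · exact fun h => absurd ((twistedFootball_polygonSize_corner a).symm.trans h) (by norm_num)
  · exact fun h => absurd ((twistedFootball_polygonSize_edge a).symm.trans h) (by norm_num)
  · exact fun h => absurd ((twistedFootball_polygonSize_pent a).symm.trans h) (by norm_num)
  · intro _
    obtain ⟨φ, hφ, h⟩ := exists_isRotation a (triangle a)
    exact ⟨FootballSide.map φ, twistedFootball_isAut_map hφ, congrArg corner h⟩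
  · intro _
    obtain ⟨φ, hφ, h⟩ := exists_isRotation a (triangle a)
    exact ⟨FootballSide.map φ, twistedFootball_isAut_map hφ, congrArg edge h⟩
  · exact fun h => absurd ((twistedFootball_polygonSize_pent a).symm.trans h) (by norm_num)
  · exact fun _ h => absurd ((twistedFootball_polygonSize_pent a).symm.trans h) (by norm_num)
  · intro _ _
    obtain ⟨φ, hφ, h⟩ := exists_isRotation a (reverse a)
    exact ⟨FootballSide.map φ, twistedFootball_isAut_map hφ, congrArg edge h⟩

/-! ### The lower bound and the conclusion -/

theorem OrientedMap.IsBranchedCover.map_next_symm {M : OrientedMap.{u}} {N : OrientedMap.{v}}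
    {f : M.Dart → N.Dart} {D : ℕ} (h : IsBranchedCover M N f D) (d : M.Dart) :
    f (M.next.symm d) = N.next.symm (f d) := by
  apply N.next.injective
  rw [← h.map_next, Equiv.apply_symm_apply, Equiv.apply_symm_apply]

/-- A common branched cover of the twisted and the standard football has degree at least 60 over
the twisted one. -/
theorem sixty_le_of_common_cover {Q : OrientedMap.{u}} {D E : ℕ} (hQ : Q.IsFootballPattern)
    (h : Q.BranchedCovers twistedFootball D) (h' : Q.BranchedCovers standardFootball E) :
    60 ≤ D := by
  obtain ⟨f, hf⟩ := h
  obtain ⟨g, hg⟩ := h'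
  have eq_pent : ∀ d, Q.polygonSize d = 5 → ∃ a b, f d = pent a ∧ g d = pent b := fun d hd => by
    obtain ⟨a, ha⟩ | ⟨a, ha⟩ | ⟨a, ha⟩ := FootballSide.cases_dart (f d)
    · obtain ⟨b, hb⟩ | ⟨b, hb⟩ | ⟨b, hb⟩ := FootballSide.cases_dart (g d)
      · exact ⟨a, b, ha, hb⟩
      · rw [hg.map_polygonSize, hb, standardFootball_polygonSize_corner] at hd
        omega
      · rw [hg.map_polygonSize, hb, standardFootball_polygonSize_edge] at hd
        omega
    · rw [hf.map_polygonSize, ha, twistedFootball_polygonSize_corner] at hd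
      omega
    · rw [hf.map_polygonSize, ha, twistedFootball_polygonSize_edge] at hd
      omega
  obtain ⟨q, hq⟩ := hQ.exists_pentagon
  obtain ⟨a₀, b₀, h₁, h₂⟩ := eq_pent q hq
  have all := forall_pair (p := fun a b => ∃ q, f q = pent a ∧ g q = pent b) (a₀ := a₀) (b₀ := b₀)
    (fun a b ⟨q, ha, hb⟩ => ⟨Q.next q, by rw [hf.map_next, ha]; rfl, by
      rw [hg.map_next, hb]; rfl⟩)
    -- Cross into the hexagon, advance two sides and cross back: this is `triangle` on both
    -- footballs.
    (fun a b ⟨q, ha, hb⟩ => ⟨Q.opp (Q.next (Q.next (Q.opp q))), by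
      rw [hf.map_opp, hf.map_next, hf.map_next, hf.map_opp, ha]; rfl, by
      rw [hg.map_opp, hg.map_next, hg.map_next, hg.map_opp, hb]; rfl⟩)
    -- Passing to the adjacent hexagon through the side after the corner gives `reverse` on the
    -- standard football. On the twisted one that side is `edge (triangle a)`, which causes the
    -- conjugation by `triangle`.
    (fun a b ⟨q, ha, hb⟩ => ⟨Q.opp (Q.next.symm (Q.opp (Q.next (Q.opp q)))), by
      rw [hf.map_opp, hf.map_next_symm, hf.map_opp, hf.map_next, hf.map_opp, ha]; rfl, by
      rw [hg.map_opp, hg.map_next_symm, hg.map_opp, hg.map_next, hg.map_opp, hb]; rfl⟩)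
    ⟨q, h₁, h₂⟩ a₀
  rw [← hf.card_fiber (pent a₀), ← standardFootball_card_pentagonal]
  choose s hs using all
  have hpent : ∀ e : {e // standardFootball.polygonSize e = 5}, ∃ b, e.1 = pent b := by
    rintro ⟨b | b | b, he⟩
    · exact ⟨b, rfl⟩
    · exact absurd ((standardFootball_polygonSize_corner b).symm.trans he) (by norm_num)
    · exact absurd ((standardFootball_polygonSize_edge b).symm.trans he) (by norm_num)
  choose t ht using hpent
  -- Each `b` has a side `s b` over `pent a₀` that `g` maps to `pent b`, so different `b` give
  -- different points of the fibre.
  refine Nat.card_le_card_of_injective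
    (fun e => (⟨s (t e), (hs (t e)).1⟩ : {d // f d = pent a₀})) fun e e' hee => ?_
  apply Subtype.ext
  have hst : s (t e) = s (t e') := congrArg Subtype.val hee
  rw [ht, ht, ← (hs (t e)).2, ← (hs (t e')).2, hst]

theorem exists_mem_commonCoverDegrees {P : OrientedMap.{u}} (hP : P.IsFootballPattern) :
    ∃ D ∈ commonCoverDegrees P, D ≤ 60 := by
  obtain ⟨Q, hQ, D, hD, h⟩ := hP.exists_common_cover standardFootball_isFootballPattern
  exact ⟨D, ⟨Q, hQ, h⟩, hD.trans standardFootball_card_pentagonal.le⟩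

theorem isLeast_commonCoverDegrees_twistedFootball :
    IsLeast (commonCoverDegrees twistedFootball) 60 := by
  have lower : 60 ∈ lowerBounds (commonCoverDegrees twistedFootball) :=
    fun D ⟨Q, hQ, h, E, h'⟩ => sixty_le_of_common_cover hQ h h'
  obtain ⟨D, hD, hle⟩ := exists_mem_commonCoverDegrees twistedFootball_isFootballPattern
  obtain rfl : D = 60 := le_antisymm hle (lower hD)
  exact ⟨hD, lower⟩

theorem mainTheorem4 :
    -- the standard football is the football pattern on the sphere with trivalent vertices
    (standardFootball.IsFootballPattern ∧ standardFootball.HasGenus 0 ∧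
      ∀ d, standardFootball.vertexDegree d = 3) ∧
    -- every football pattern has a branched cover of degree at most 60
    -- that is also a branched cover of the standard football
    (∀ P : OrientedMap.{u}, P.IsFootballPattern →
      ∃ D ∈ commonCoverDegrees P, D ≤ 60) ∧
    -- the bound is attained by a symmetric football pattern of genus 24 with `d = 2`
    (twistedFootball.IsSymmetricFootball ∧
      twistedFootball.HasGenus 24 ∧
      twistedFootball.numPolygons 5 = 6 * 2 ∧
      twistedFootball.numPolygons 6 = 10 * 2 ∧
      IsLeast (commonCoverDegrees twistedFootball) 60) :=
  ⟨⟨standardFootball_isFootballPattern, standardFootball_hasGenus, standardFootball_vertexDegree⟩,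
    fun _ hP => exists_mem_commonCoverDegrees hP,
    twistedFootball_isSymmetricFootball, twistedFootball_hasGenus,
    twistedFootball_numPolygons_five, twistedFootball_numPolygons_six,
    isLeast_commonCoverDegrees_twistedFootball⟩
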